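/- Let $X$ be a Hausdorff topological space. An open cover $\mathscr{U}$ of $X$ is \emph{normal} if there is a sequence $\mathscr{V}_0=\mathscr{U},\mathscr{V}_1,\mathscr{V}_2,\dots$ of open covers of $X$ such that, for every $n$, $\mathscr{V}_{n+1}$ star-refines $\mathscr{V}_n$, i.e. for every $V\in\mathscr{V}_{n+1}$ the union of all members of $\mathscr{V}_{n+1}$ meeting $V$ is contained in some member of $\mathscr{V}_n$. The space $X$ is \emph{PF-normal} if every point-finite open cover of $X$ is normal, and \emph{countably paracompact} if every countable open cover of $X$ has a locally finite open refinement that covers $X$. A set-valued mapping $\Phi$ assigning to each $x\in X$ a nonempty subset $\Phi(x)$ of a space $E$ is \emph{lower semi-continuous} (l.s.c.) if $\{x\in X:\Phi(x)\cap U\neq\emptyset\}$ is open in $X$ for every open $U\subset E$; a \emph{continuous selection} for $\Phi$ is a continuous map $f:X\to E$ with $f(x)\in\Phi(x)$ for every $x\in X$. A subset of a real normed space $E$ is called \emph{finite-dimensional} if it is contained in some finite-dimensional affine subspace of $E$. \textbf{Theorem.} The space $X$ is countably paracompact and PF-normal if and only if for every real normed space $E$ (not necessarily complete), every l.s.c.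 mapping $\Phi$ from $X$ into the nonempty closed convex subsets of $E$, such that each value $\Phi(x)$, $x\in X$, is either compact or finite-dimensional, has a continuous selection. -/

import Mathlib

open Set

universe u v

/-- `𝒰` is an open cover of the space `X`. -/
def IsOpenCoverOf {X : Type*} [TopologicalSpace X] (𝒰 : Set (Set X)) : Prop :=
  (∀ U ∈ 𝒰, IsOpen U) ∧ ⋃₀ 𝒰 = univ

/-- `𝒱` refines `𝒰`: every member of `𝒱` is contained in some member of `𝒰`. -/
def Refines {X : Type*} (𝒱 𝒰 : Set (Set X)) : Prop :=
  ∀ V ∈ 𝒱, ∃ U ∈ 𝒰, V ⊆ U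

/-- The star of the set `S` with respect to `𝒱`: the union of the members of `𝒱` meeting `S`. -/
def starOf {X : Type*} (𝒱 : Set (Set X)) (S : Set X) : Set X :=
  ⋃₀ {W ∈ 𝒱 | (W ∩ S).Nonempty}

/-- `𝒱` star-refines `𝒰`: the star of every member of `𝒱` is contained in some member of `𝒰`. -/
def StarRefines {X : Type*} (𝒱 𝒰 : Set (Set X)) : Prop :=
  ∀ V ∈ 𝒱, ∃ U ∈ 𝒰, starOf 𝒱 V ⊆ U

/-- A normal open cover (in the sense of Tukey): the first term of a sequence of open covers,
each of which is star-refined by the next one. -/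
def IsNormalCover {X : Type*} [TopologicalSpace X] (𝒰 : Set (Set X)) : Prop :=
  ∃ 𝒱 : ℕ → Set (Set X), 𝒱 0 = 𝒰 ∧ (∀ n, IsOpenCoverOf (𝒱 n)) ∧
    ∀ n, StarRefines (𝒱 (n + 1)) (𝒱 n)

/-- Every point belongs to at most finitely many members of `𝒰`. -/
def IsPointFinite {X : Type*} (𝒰 : Set (Set X)) : Prop :=
  ∀ x, {U ∈ 𝒰 | x ∈ U}.Finite

/-- A space is PF-normal if every point-finite open cover of it is normal. -/
def PFNormal (X : Type*) [TopologicalSpace X] : Prop :=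
  ∀ 𝒰 : Set (Set X), IsOpenCoverOf 𝒰 → IsPointFinite 𝒰 → IsNormalCover 𝒰

/-- A space is countably paracompact if every countable open cover of it has a locally finite
open refinement (which is again a cover). -/
def CountablyParacompact (X : Type*) [TopologicalSpace X] : Prop :=
  ∀ 𝒰 : Set (Set X), IsOpenCoverOf 𝒰 → 𝒰.Countable →
    ∃ 𝒱 : Set (Set X), IsOpenCoverOf 𝒱 ∧ Refines 𝒱 𝒰 ∧ LocallyFinite (fun V : 𝒱 => (V : Set X))

/-- A subset of a real normed space is finite-dimensional if it is contained in some
finite-dimensional affine subspace. -/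
def IsFiniteDimensionalSet {E : Type*} [NormedAddCommGroup E] [NormedSpace ℝ E]
    (S : Set E) : Prop :=
  ∃ A : AffineSubspace ℝ E, FiniteDimensional ℝ A.direction ∧ S ⊆ (A : Set E)

/-! A normal cover comes from a coarser pseudometrizable topology, where partitions of unity exist,
so on a PF-normal space vectors attached to a point-finite open cover average continuously. For
compact values this drives Michael's iteration: a locally finite cover of `E` by small sets pulls
back to a point-finite cover of `X`, and compactness of the values replaces completeness of `E` in
the limit. Countable paracompactness supplies a continuous radius `g` with `Φ x` meeting `ball 0 (g
x)`; cutting down to that ball makes finite-dimensional values compact.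

Conversely, normality of a cover is read off a selection from simplices in ℓ^∞ spanned by its
members, and local finiteness off a selection from half-lines. -/

open Filter Topology Metric Uniformity

/-! ### Normal covers and continuous averaging -/

section Normal

variable {X : Type*}

/-- The relation of belonging to a common member of `𝒱`. -/
def coverRel (𝒱 : Set (Set X)) : Set (X × X) := {p | ∃ V ∈ 𝒱, p.1 ∈ V ∧ p.2 ∈ V}

theorem StarRefines.subset_of_mem {𝒱 𝒰 : Set (Set X)} (h : StarRefines 𝒱 𝒰) {V : Set X}
    (hV : V ∈ 𝒱) {x : X} (hx : x ∈ V) :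
    ∃ U ∈ 𝒰, ∀ W ∈ 𝒱, x ∈ W → W ⊆ U := by
  obtain ⟨U, hU, hVU⟩ := h V hV
  exact ⟨U, hU, fun W hW hxW => (show W ⊆ starOf 𝒱 V from
    subset_sUnion_of_mem (mem_sep hW ⟨x, hxW, hx⟩)).trans hVU⟩

theorem StarRefines.coverRel_comp {𝒱 𝒰 : Set (Set X)} (h : StarRefines 𝒱 𝒰) {x y z : X}
    (hxy : (x, y) ∈ coverRel 𝒱) (hyz : (y, z) ∈ coverRel 𝒱) : (x, z) ∈ coverRel 𝒰 := by
  obtain ⟨V, hV, hx, hy⟩ := hxy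
  obtain ⟨W, hW, hy', hz⟩ := hyz
  obtain ⟨U, hU, hsub⟩ := h.subset_of_mem hV hy
  exact ⟨U, hU, hsub V hV hy hx, hsub W hW hy' hz⟩

theorem IsOpenCoverOf.exists_mem [TopologicalSpace X] {𝒰 : Set (Set X)} (h : IsOpenCoverOf 𝒰) (x : X) :
    ∃ U ∈ 𝒰, x ∈ U := by
  have : x ∈ ⋃₀ 𝒰 := h.2 ▸ mem_univ x
  exact this

theorem isOpenCoverOf_range [TopologicalSpace X] {ι : Type*} {U : ι → Set X} (ho : ∀ i, IsOpen (U i))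
    (hc : ∀ x, ∃ i, x ∈ U i) : IsOpenCoverOf (range U) :=
  ⟨forall_mem_range.2 ho, eq_univ_of_forall fun x =>
    let ⟨i, hi⟩ := hc x; ⟨U i, mem_range_self i, hi⟩⟩

/-- A normal cover is refined by the balls of a coarser, countably generated uniformity. -/
theorem IsNormalCover.exists_uniformSpace [t : TopologicalSpace X] {𝒰 : Set (Set X)}
    (h : IsNormalCover 𝒰) :
    ∃ u : UniformSpace X, (𝓤[u]).IsCountablyGenerated ∧ t ≤ u.toTopologicalSpace ∧
      ∀ x, ∃ U ∈ 𝒰, U ∈ @nhds X u.toTopologicalSpace x := by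
  obtain ⟨𝒱, h0, hcov, hstar⟩ := h
  have hrefl : ∀ n x, (x, x) ∈ coverRel (𝒱 n) := fun n x =>
    let ⟨V, hV, hx⟩ := (hcov n).exists_mem x; ⟨V, hV, hx, hx⟩
  have hanti : Antitone fun n => coverRel (𝒱 n) := antitone_nat_of_succ_le fun n p hp =>
    (hstar n).coverRel_comp (y := p.1) (hrefl _ _) hp
  have hb : (⨅ n, 𝓟 (coverRel (𝒱 n))).HasBasis (fun _ => True) fun n => coverRel (𝒱 n) :=
    hasBasis_iInf_principal hanti.directed_ge
  let c : UniformSpace.Core X :=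
    { uniformity := ⨅ n, 𝓟 (coverRel (𝒱 n))
      refl := by
        refine hb.ge_iff.2 fun n _ => ?_
        rintro ⟨x, y⟩ hxy
        obtain rfl : x = y := by simpa using hxy
        exact hrefl n x
      symm := (hb.tendsto_iff hb).2 fun n _ => ⟨n, trivial, fun p ⟨V, hV, h1, h2⟩ =>
        ⟨V, hV, h2, h1⟩⟩
      comp := by
        refine ((hb.lift' (monotone_id.relComp monotone_id)).le_basis_iff hb).2 fun n _ =>
          ⟨n + 1, trivial, ?_⟩
        rintro ⟨x, z⟩ ⟨y, hxy, hyz⟩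
        exact (hstar n).coverRel_comp hxy hyz }
  let u : UniformSpace X := UniformSpace.ofCore c
  have hb' : (𝓤[u]).HasBasis (fun _ => True) fun n => coverRel (𝒱 n) := hb
  have hnhds : ∀ x, (@nhds X u.toTopologicalSpace x).HasBasis (fun _ => True)
      fun n => {y | (x, y) ∈ coverRel (𝒱 n)} := fun x =>
    @nhds_basis_uniformity' X ℕ u _ _ hb' x
  refine ⟨u, hb'.isCountablyGenerated, ?_, fun x => ?_⟩
  · refine le_of_nhds_le_nhds fun x => (hnhds x).ge_iff.2 fun n _ => ?_
    obtain ⟨V, hV, hx⟩ := (hcov n).exists_mem x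
    exact mem_of_superset (((hcov n).1 V hV).mem_nhds hx) fun y hy => ⟨V, hV, hx, hy⟩
  -- Level 1 is needed: the star of `x` in `𝒱 1` lies in a single member of `𝒱 0 = 𝒰`.
  · obtain ⟨V, hV, hx⟩ := (hcov 1).exists_mem x
    obtain ⟨U, hU, hsub⟩ := (hstar 0).subset_of_mem hV hx
    refine ⟨U, h0 ▸ hU, (hnhds x).mem_iff.2 ⟨1, trivial, ?_⟩⟩
    rintro y ⟨W, hW, hxW, hyW⟩
    exact hsub W hW hxW hyW

/-- Constants `e i` are local solutions, glued by a partition of unity. Neighbourhoods suffice, as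
`U i` need not be open in the coarser topology. -/
theorem exists_continuous_mem_convexHull_of_mem_nhds [TopologicalSpace X]
    [TopologicalSpace.PseudoMetrizableSpace X] {ι E : Type*} [NormedAddCommGroup E]
    [NormedSpace ℝ E] {U : ι → Set X} (hU : ∀ x, ∃ i, U i ∈ 𝓝 x) (e : ι → E) :
    ∃ f : X → E, Continuous f ∧ ∀ x, f x ∈ convexHull ℝ (e '' {i | x ∈ U i}) := by
  let := TopologicalSpace.pseudoMetrizableSpacePseudoMetric X
  obtain ⟨g, hg⟩ := exists_continuous_forall_mem_convex_of_local_const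
    (t := fun x => convexHull ℝ (e '' {i | x ∈ U i})) (fun x => convex_convexHull ℝ _) fun x => by
      obtain ⟨i, hi⟩ := hU x
      exact ⟨e i, mem_of_superset hi fun y hy => subset_convexHull ℝ _ ⟨i, hy, rfl⟩⟩
  exact ⟨g, g.continuous, hg⟩

/-- On a PF-normal space, vectors attached to the members of a point-finite open cover can be
averaged continuously. -/
theorem PFNormal.exists_continuous_mem_convexHull [TopologicalSpace X] (hX : PFNormal X) {ι E : Type*}
    [NormedAddCommGroup E] [NormedSpace ℝ E] (U : ι → Set X) (ho : ∀ i, IsOpen (U i))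
    (hc : ∀ x, ∃ i, x ∈ U i) (hf : ∀ x, {i | x ∈ U i}.Finite) (e : ι → E) :
    ∃ f : X → E, Continuous f ∧ ∀ x, f x ∈ convexHull ℝ (e '' {i | x ∈ U i}) := by
  have hpf : IsPointFinite (range U) := fun x => by
    refine ((hf x).image U).subset ?_
    rintro _ ⟨⟨i, rfl⟩, hi⟩
    exact ⟨i, hi, rfl⟩
  obtain ⟨u, hu, hle, hnhds⟩ := (hX _ (isOpenCoverOf_range ho hc) hpf).exists_uniformSpace
  have hps : @TopologicalSpace.PseudoMetrizableSpace X u.toTopologicalSpace :=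
    @UniformSpace.pseudoMetrizableSpace X u hu
  obtain ⟨f, hfc, hfm⟩ := @exists_continuous_mem_convexHull_of_mem_nhds X u.toTopologicalSpace
    hps ι E _ _ U (fun x => let ⟨_, ⟨i, hi⟩, hx⟩ := hnhds x; ⟨i, hi ▸ hx⟩) e
  exact ⟨f, continuous_le_dom hle hfc, hfm⟩

end Normal

/-! ### Construction of selections -/

section Selection

variable {X : Type*} [TopologicalSpace X] {E : Type*} [NormedAddCommGroup E] [NormedSpace ℝ E]

theorem LowerHemicontinuous.isOpen_inter_nonempty {X E : Type*} [TopologicalSpace X]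
    [TopologicalSpace E] {Φ : X → Set E} (h : LowerHemicontinuous Φ)
    {O : Set E} (hO : IsOpen O) : IsOpen {x | (Φ x ∩ O).Nonempty} :=
  lowerHemicontinuous_iff_isOpen_inter_nonempty.1 h O hO

theorem LowerHemicontinuous.closure {X E : Type*} [TopologicalSpace X]
    [TopologicalSpace E] {Φ : X → Set E} (h : LowerHemicontinuous Φ) :
    LowerHemicontinuous fun x => closure (Φ x) := by
  rw [lowerHemicontinuous_iff_isOpen_inter_nonempty] at h ⊢
  intro O hO
  simpa only [closure_inter_open_nonempty_iff hO] using h O hO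

theorem LowerHemicontinuous.closure_inter_ball {X E : Type*} [TopologicalSpace X]
    [PseudoMetricSpace E] {Φ : X → Set E} (h : LowerHemicontinuous Φ) {c : X → E} {r : X → ℝ}
    (hc : Continuous c) (hr : Continuous r) :
    LowerHemicontinuous fun x => _root_.closure (Φ x ∩ ball (c x) (r x)) := by
  refine (h.inter_hasOpenCGraph (g := fun x => ball (c x) (r x)) ?_).closure
  exact isOpen_lt (continuous_snd.dist (hc.comp continuous_fst)) (hr.comp continuous_fst)

/-- A compact value meets only finitely many members of a locally finite cover of `E`, so the
induced cover of `X` is point-finite. -/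
theorem PFNormal.exists_approximate_selection (hX : PFNormal X) {Φ : X → Set E}
    (hne : ∀ x, (Φ x).Nonempty) (hcv : ∀ x, Convex ℝ (Φ x)) (hcp : ∀ x, IsCompact (Φ x))
    (hΦ : LowerHemicontinuous Φ) {ε : ℝ} (hε : 0 < ε) :
    ∃ f : X → E, Continuous f ∧ ∀ x, f x ∈ thickening ε (Φ x) := by
  obtain ⟨W, hWo, hWc, hWf, hWs⟩ := precise_refinement (fun y : E => ball y ε)
    (fun y => isOpen_ball) (eq_univ_of_forall fun y => mem_iUnion.2 ⟨y, mem_ball_self hε⟩)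
  obtain ⟨f, hf, hfm⟩ := hX.exists_continuous_mem_convexHull
    (fun y => {x | (Φ x ∩ W y).Nonempty}) (fun y => hΦ.isOpen_inter_nonempty (hWo y))
    (fun x => by
      obtain ⟨z, hz⟩ := hne x
      obtain ⟨y, hy⟩ := mem_iUnion.1 (hWc ▸ mem_univ z)
      exact ⟨y, z, hz, hy⟩)
    (fun x => by
      simpa only [mem_ofPred_eq, inter_comm] using hWf.finite_nonempty_inter_compact (hcp x)) id
  refine ⟨f, hf, fun x => convexHull_min ?_ ((hcv x).thickening ε) (hfm x)⟩
  rintro _ ⟨y, ⟨z, hz, hzy⟩, rfl⟩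
  exact mem_thickening_iff.2 ⟨z, hz, mem_ball'.1 (hWs y hzy)⟩

theorem PFNormal.exists_next_approximate_selection (hX : PFNormal X) {Φ : X → Set E}
    (hcv : ∀ x, Convex ℝ (Φ x)) (hcp : ∀ x, IsCompact (Φ x))
    (hΦ : LowerHemicontinuous Φ) {ε δ : ℝ} (hδ : 0 < δ) {f : X → E} (hf : Continuous f)
    (hfΦ : ∀ x, f x ∈ thickening ε (Φ x)) :
    ∃ g : X → E, Continuous g ∧ (∀ x, g x ∈ thickening δ (Φ x)) ∧
      ∀ x, dist (f x) (g x) ≤ ε + δ := by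
  have hsub : ∀ x, closure (Φ x ∩ ball (f x) ε) ⊆ Φ x := fun x =>
    closure_minimal inter_subset_left (hcp x).isClosed
  obtain ⟨g, hg, hgΦ⟩ := hX.exists_approximate_selection
    (Φ := fun x => closure (Φ x ∩ ball (f x) ε))
    (fun x => by
      obtain ⟨z, hz, hzf⟩ := mem_thickening_iff.1 (hfΦ x)
      exact ⟨z, subset_closure ⟨hz, mem_ball'.2 hzf⟩⟩)
    (fun x => ((hcv x).inter (convex_ball _ _)).closure)
    (fun x => (hcp x).of_isClosed_subset isClosed_closure (hsub x))
    (hΦ.closure_inter_ball hf continuous_const) hδ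
  refine ⟨g, hg, fun x => thickening_subset_of_subset _ (hsub x) (hgΦ x), fun x => ?_⟩
  obtain ⟨z, hz, hgz⟩ := mem_thickening_iff.1 (hgΦ x)
  have hz' : dist z (f x) ≤ ε :=
    mem_closedBall.1 (closure_ball_subset_closedBall (closure_mono inter_subset_right hz))
  have := dist_triangle_right (f x) (g x) z
  rw [dist_comm z] at hz'
  linarith

/-- On a PF-normal space, lower hemicontinuous maps with compact convex values have selections. -/
theorem PFNormal.exists_selection_of_isCompact (hX : PFNormal X) {Φ : X → Set E}
    (hne : ∀ x, (Φ x).Nonempty) (hcv : ∀ x, Convex ℝ (Φ x)) (hcp : ∀ x, IsCompact (Φ x))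
    (hΦ : LowerHemicontinuous Φ) : ∃ f : X → E, Continuous f ∧ ∀ x, f x ∈ Φ x := by
  have hpos : ∀ n : ℕ, (0 : ℝ) < 1 / 2 ^ n := fun n => by positivity
  obtain ⟨f₀, hf₀, hf₀Φ⟩ := hX.exists_approximate_selection hne hcv hcp hΦ (hpos 0)
  have step : ∀ (n : ℕ) (f : {f : X → E // Continuous f ∧ ∀ x, f x ∈ thickening (1 / 2 ^ n) (Φ x)}),
      ∃ g : {g : X → E // Continuous g ∧ ∀ x, g x ∈ thickening (1 / 2 ^ (n + 1)) (Φ x)},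
        ∀ x, dist (f.1 x) (g.1 x) ≤ 1 / 2 ^ n + 1 / 2 ^ (n + 1) := fun n f =>
    let ⟨g, hg, hgΦ, hd⟩ := hX.exists_next_approximate_selection hcv hcp hΦ (hpos (n + 1))
      f.2.1 f.2.2
    ⟨⟨g, hg, hgΦ⟩, hd⟩
  choose next hnext using step
  let F : ∀ n : ℕ, {f : X → E // Continuous f ∧ ∀ x, f x ∈ thickening (1 / 2 ^ n) (Φ x)} :=
    fun n => Nat.rec ⟨f₀, hf₀, hf₀Φ⟩ next n
  have hF : ∀ n x, dist ((F n).1 x) ((F (n + 1)).1 x) ≤ 4 / 2 / 2 ^ n := fun n x => by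
    refine (hnext n (F n) x).trans ?_
    rw [pow_succ]
    have := hpos n
    field_simp
    norm_num
  have hz : ∀ x, ∃ z : ℕ → E, (∀ n, z n ∈ Φ x) ∧ ∀ n, dist ((F n).1 x) (z n) < 1 / 2 ^ n :=
    fun x => by
      choose z hz hd using fun n => mem_thickening_iff.1 ((F n).2.2 x)
      exact ⟨z, hz, hd⟩
  have hlim : ∀ x, ∃ a ∈ Φ x, Tendsto (fun n => (F n).1 x) atTop (𝓝 a) := fun x => by
    obtain ⟨z, hz, hd⟩ := hz x
    have h0 : Tendsto (fun n => dist ((F n).1 x) (z n)) atTop (𝓝 0) :=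
      squeeze_zero (fun _ => dist_nonneg) (fun n => (hd n).le) <| by
        simpa using tendsto_pow_atTop_nhds_zero_of_lt_one (r := (1 / 2 : ℝ)) (by norm_num)
          (by norm_num)
    -- A Cauchy sequence with a convergent subsequence converges, so `E` need not be complete.
    obtain ⟨a, ha, φ, hφ, hza⟩ := (hcp x).tendsto_subseq hz
    refine ⟨a, ha, tendsto_nhds_of_cauchySeq_of_subseq
      (cauchySeq_of_le_geometric_two (hF · x)) hφ.tendsto_atTop ?_⟩
    exact tendsto_of_tendsto_of_dist hza (by
      simpa only [dist_comm, Function.comp_def] using h0.comp hφ.tendsto_atTop)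
  choose f hfΦ hf using hlim
  refine ⟨f, ?_, hfΦ⟩
  have hunif : TendstoUniformly (fun n => (F n).1) f atTop := by
    refine Metric.tendstoUniformly_iff.2 fun ε hε => ?_
    have h4 : Tendsto (fun n : ℕ => (4 : ℝ) / 2 ^ n) atTop (𝓝 0) := by
      simpa [div_eq_mul_inv] using (tendsto_pow_atTop_nhds_zero_of_lt_one (r := (1 / 2 : ℝ))
        (by norm_num) (by norm_num)).const_mul 4
    filter_upwards [h4.eventually_lt_const hε] with n hn x
    rw [dist_comm]
    exact (dist_le_of_le_geometric_two_of_tendsto (hF · x) (hf x) n).trans_lt hn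
  exact hunif.continuous (.of_forall fun n => (F n).2.1)

/-- A continuous function dominating an index function of a countable open cover. -/
theorem exists_continuous_ge_of_cover (hcp : CountablyParacompact X) (hX : PFNormal X)
    {U : ℕ → Set X} (ho : ∀ n, IsOpen (U n)) (hc : ∀ x, ∃ n, x ∈ U n) :
    ∃ g : X → ℝ, Continuous g ∧ ∀ x, ∃ n : ℕ, (n : ℝ) ≤ g x ∧ x ∈ U n := by
  obtain ⟨𝒱, hcov, href, hlf⟩ := hcp _ (isOpenCoverOf_range ho hc) (countable_range U)
  have hN : ∀ V : 𝒱, ∃ n, (V : Set X) ⊆ U n := fun V => by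
    obtain ⟨_, ⟨n, rfl⟩, hn⟩ := href V V.2
    exact ⟨n, hn⟩
  choose N hN using hN
  obtain ⟨g, hg, hgm⟩ := hX.exists_continuous_mem_convexHull (fun V : 𝒱 => (V : Set X))
    (fun V => hcov.1 V V.2)
    (fun x => let ⟨V, hV, hx⟩ := hcov.exists_mem x; ⟨⟨V, hV⟩, hx⟩)
    hlf.point_finite (fun V => (N V : ℝ))
  refine ⟨g, hg, fun x => ?_⟩
  classical
  -- Every `V` containing `x` has `N V` at least the least index at `x`, hence so does any average.
  refine ⟨Nat.find (hc x), ?_, Nat.find_spec (hc x)⟩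
  refine convexHull_min (t := Ici (Nat.find (hc x) : ℝ)) ?_ (convex_Ici _) (hgm x)
  rintro _ ⟨V, hV, rfl⟩
  exact (Nat.cast_le.2 (Nat.find_min' (hc x) (hN V hV)) : (Nat.find (hc x) : ℝ) ≤ N V)

theorem IsFiniteDimensionalSet.isCompact_of_isClosed_of_isBounded {S : Set E}
    (h : IsFiniteDimensionalSet S) (hc : IsClosed S) (hb : Bornology.IsBounded S) :
    IsCompact S := by
  obtain ⟨A, hA, hSA⟩ := h
  rcases S.eq_empty_or_nonempty with rfl | ⟨p, hp⟩
  · exact isCompact_empty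
  let φ : A.direction → E := fun v => (v : E) + p
  have hφ : Isometry φ := fun v w => by simp [φ]; rfl
  have hrange : S ⊆ range φ := fun q hq =>
    ⟨⟨q - p, A.vsub_mem_direction (hSA hq) (hSA hp)⟩, by simp [φ]⟩
  have : ProperSpace A.direction := FiniteDimensional.proper ℝ _
  have hK : IsCompact (φ ⁻¹' S) := isCompact_of_isClosed_isBounded (hc.preimage hφ.continuous)
    (hφ.antilipschitz.isBounded_preimage hb)
  simpa [image_preimage_eq_of_subset hrange] using hK.image hφ.continuous

theorem CountablyParacompact.exists_selection (hcp : CountablyParacompact X) (hX : PFNormal X)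
    {Φ : X → Set E} (h : ∀ x, (Φ x).Nonempty ∧ IsClosed (Φ x) ∧ Convex ℝ (Φ x))
    (hfin : ∀ x, IsCompact (Φ x) ∨ IsFiniteDimensionalSet (Φ x)) (hΦ : LowerHemicontinuous Φ) :
    ∃ f : X → E, Continuous f ∧ ∀ x, f x ∈ Φ x := by
  obtain ⟨g, hg, hgm⟩ := exists_continuous_ge_of_cover hcp hX
    (U := fun n : ℕ => {x | (Φ x ∩ ball 0 n).Nonempty})
    (fun n => hΦ.isOpen_inter_nonempty isOpen_ball)
    (fun x => by
      obtain ⟨z, hz⟩ := (h x).1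
      obtain ⟨n, hn⟩ := exists_nat_gt ‖z‖
      exact ⟨n, z, hz, by simpa using hn⟩)
  have hsub : ∀ x, closure (Φ x ∩ ball 0 (g x)) ⊆ Φ x := fun x =>
    closure_minimal inter_subset_left (h x).2.1
  obtain ⟨f, hf, hfm⟩ := hX.exists_selection_of_isCompact
    (Φ := fun x => closure (Φ x ∩ ball 0 (g x)))
    (fun x => by
      obtain ⟨n, hn, hx⟩ := hgm x
      exact (hx.mono (inter_subset_inter_right _ (ball_subset_ball hn))).closure)
    (fun x => ((h x).2.2.inter (convex_ball _ _)).closure)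
    (fun x => by
      rcases hfin x with hx | ⟨A, hA, hx⟩
      · exact hx.of_isClosed_subset isClosed_closure (hsub x)
      · exact IsFiniteDimensionalSet.isCompact_of_isClosed_of_isBounded
          ⟨A, hA, (hsub x).trans hx⟩ isClosed_closure
          (isBounded_ball.subset inter_subset_right).closure)
    (hΦ.closure_inter_ball continuous_const hg)
  exact ⟨f, hf, fun x => hsub x (hfm x)⟩

end Selection

/-! ### From selections back to covers -/

section Converse

variable {X : Type*} [TopologicalSpace X]

/-- A cover with a uniform Lebesgue number for a continuous map into a metric space is normal. -/
theorem isNormalCover_of_lebesgue_number {Y : Type*} [PseudoMetricSpace Y] {g : X → Y}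
    (hg : Continuous g) {𝒰 : Set (Set X)} (h𝒰 : IsOpenCoverOf 𝒰) {δ : ℝ} (hδ : 0 < δ)
    (hL : ∀ x, ∃ U ∈ 𝒰, g ⁻¹' ball (g x) δ ⊆ U) : IsNormalCover 𝒰 := by
  let ℬ : ℝ → Set (Set X) := fun r => range fun x => g ⁻¹' ball (g x) r
  have hcov : ∀ r, 0 < r → IsOpenCoverOf (ℬ r) := fun r hr =>
    isOpenCoverOf_range (fun x => isOpen_ball.preimage hg) fun x => ⟨x, mem_ball_self hr⟩
  have hstar : ∀ r x, starOf (ℬ (r / 3)) (g ⁻¹' ball (g x) (r / 3)) ⊆ g ⁻¹' ball (g x) r := by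
    rintro r x y ⟨_, ⟨⟨z, rfl⟩, w, hw, hw'⟩, hy⟩
    simp only [mem_preimage, mem_ball] at *
    have h1 := dist_triangle (g y) (g z) (g x)
    have h2 := dist_triangle_left (g z) (g x) (g w)
    linarith
  -- The first radius is `δ / 3`, so that stars fit in `δ`-balls and hence in members of `𝒰`.
  refine ⟨fun n => Nat.casesOn n 𝒰 fun k => ℬ (δ / 3 ^ (k + 1)), rfl, ?_, ?_⟩
  · rintro (_ | n)
    · exact h𝒰
    · exact hcov _ (by positivity)
  · rintro (_ | n) _ ⟨x, rfl⟩
    · obtain ⟨U, hU, hsub⟩ := hL x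
      refine ⟨U, hU, ?_⟩
      simpa using (hstar δ x).trans hsub
    · refine ⟨_, ⟨x, rfl⟩, ?_⟩
      simpa only [pow_succ _ (n + 1), ← div_div] using hstar (δ / 3 ^ (n + 1)) x

end Converse

/-- The selection property in the main theorem. -/
def SelectionProperty (X : Type u) [TopologicalSpace X] : Prop :=
  ∀ (E : Type (max u v)) [NormedAddCommGroup E] [NormedSpace ℝ E] (Φ : X → Set E),
    (∀ x, (Φ x).Nonempty ∧ IsClosed (Φ x) ∧ Convex ℝ (Φ x)) →
    (∀ x, IsCompact (Φ x) ∨ IsFiniteDimensionalSet (Φ x)) →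
    LowerHemicontinuous Φ →
    ∃ f : X → E, Continuous f ∧ ∀ x, f x ∈ Φ x

theorem lowerHemicontinuous_of_eventually_mem {X E : Type*} [TopologicalSpace X]
    [TopologicalSpace E] {Φ : X → Set E} (h : ∀ x, ∀ᶠ x' in 𝓝 x, Φ x ⊆ Φ x') :
    LowerHemicontinuous Φ := by
  refine lowerHemicontinuous_iff.2 fun x => lowerHemicontinuousAt_iff.2 fun O _ hO => ?_
  filter_upwards [h x] with x' hx'
  exact hO.mono (inter_subset_inter_left _ hx')

/-- Coordinate `i` of the selection vanishes off the `i`-th member. After scaling to sup norm 1,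
some coordinate exceeds 1/2 in absolute value and cannot vanish within distance 1/2, which gives a
Lebesgue number. -/
theorem SelectionProperty.pfNormal {X : Type u} [TopologicalSpace X]
    (h : SelectionProperty.{u, v} X) : PFNormal X := by
  classical
  intro 𝒰 h𝒰 hpf
  let I := ULift.{v} 𝒰
  let E := lp (fun _ : I => ℝ) ⊤
  have hsmul : ∀ (a : ℝ) (y : E) i, (a • y) i = a * y i := fun _ _ _ => rfl
  have hadd : ∀ (y z : E) i, (y + z) i = y i + z i := fun _ _ _ => rfl
  let S : X → Set I := fun x => {i | x ∈ (i.down : Set X)}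
  have hS : ∀ x, (S x).Finite := fun x => by
    refine Set.Finite.of_finite_image (f := fun i : I => (i.down : Set X)) ((hpf x).subset ?_)
      fun i _ j _ hij => ULift.ext _ _ (Subtype.ext hij)
    rintro _ ⟨i, hi, rfl⟩
    exact ⟨i.down.2, hi⟩
  let e : I → E := fun i => lp.single ⊤ i (1 : ℝ)
  have hfinite : ∀ x, (e '' S x).Finite := fun x => (hS x).image e
  obtain ⟨f, hf, hfm⟩ := h E (fun x => convexHull ℝ (e '' S x))
    (fun x => ⟨by
      obtain ⟨U, hU, hx⟩ := h𝒰.exists_mem x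
      exact convexHull_nonempty_iff.2 ⟨_, ⟨⟨U, hU⟩⟩, hx, rfl⟩,
      (hfinite x).isClosed_convexHull ℝ, convex_convexHull ℝ _⟩)
    (fun x => .inl ((hfinite x).isCompact_convexHull ℝ))
    (lowerHemicontinuous_of_eventually_mem fun x => by
      have : ∀ᶠ x' in 𝓝 x, ∀ i ∈ S x, x' ∈ (i.down : Set X) :=
        (eventually_all_finite (hS x)).2 fun i hi => (h𝒰.1 _ i.down.2).mem_nhds hi
      filter_upwards [this] with x' hx'
      exact convexHull_mono (image_mono hx'))
  have hzero : ∀ x i, f x i ≠ 0 → x ∈ (i.down : Set X) := fun x i hi => by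
    by_contra hx
    refine hi (convexHull_min (t := {y : E | y i = 0}) ?_ ?_ (hfm x))
    · rintro _ ⟨j, hj, rfl⟩
      have : i ≠ j := by rintro rfl; exact hx hj
      simp [e, lp.single_apply, this]
    · intro y hy z hz a b _ _ _
      simp only [mem_ofPred_eq] at hy hz ⊢
      simp [hadd, hsmul, hy, hz]
  have hne : ∀ x, f x ≠ 0 := fun x h0 => by
    have hsum : ∑ i ∈ (hS x).toFinset, f x i = 1 := by
      refine convexHull_min (t := {y : E | ∑ i ∈ (hS x).toFinset, y i = 1}) ?_ ?_ (hfm x)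
      · rintro _ ⟨j, hj, rfl⟩
        have : j ∈ (hS x).toFinset := (hS x).mem_toFinset.2 hj
        refine (Finset.sum_eq_single j (fun i _ hij => ?_) fun h => absurd this h).trans ?_
        · simp [e, lp.single_apply, hij]
        · simp [e, lp.single_apply]
      · intro y hy z hz a b _ _ hab
        simp only [mem_ofPred_eq] at hy hz
        simp only [mem_ofPred_eq]
        simp [hadd, hsmul, Finset.sum_add_distrib, ← Finset.mul_sum, hy, hz, hab]
    simp [h0] at hsum
  have hnorm : ∀ x, 0 < ‖f x‖ := fun x => norm_pos_iff.2 (hne x)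
  let g : X → E := fun x => ‖f x‖⁻¹ • f x
  have hg : Continuous g := (hf.norm.inv₀ fun x => (hnorm x).ne').smul hf
  refine isNormalCover_of_lebesgue_number hg h𝒰 (δ := 1 / 2) (by norm_num) fun x => ?_
  have hg1 : ‖g x‖ = 1 := by simp [g, norm_smul, (hnorm x).ne']
  obtain ⟨i, hi⟩ : ∃ i, 1 / 2 < ‖g x i‖ := by
    by_contra! hcon
    have := lp.norm_le_of_forall_le (by norm_num) hcon
    norm_num [hg1] at this
  refine ⟨i.down, i.down.2, fun y hy => hzero y i fun hy0 => ?_⟩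
  have h1 : ‖(g y - g x) i‖ ≤ ‖g y - g x‖ := lp.norm_apply_le_norm ENNReal.top_ne_zero _ i
  have h2 : ‖g y - g x‖ < 1 / 2 := by
    rw [← dist_eq_norm]; exact hy
  have h3 : (g y - g x) i = - g x i := by
    change ‖f y‖⁻¹ * f y i - g x i = _
    rw [hy0]; ring
  rw [h3, norm_neg] at h1
  linarith

theorem SelectionProperty.countablyParacompact {X : Type u} [TopologicalSpace X]
    (h : SelectionProperty.{u, v} X) : CountablyParacompact X := by
  classical
  intro 𝒰 h𝒰 hcount
  rcases 𝒰.eq_empty_or_nonempty with rfl | hne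
  · exact ⟨∅, h𝒰, fun V hV => hV.elim, fun x => ⟨univ, univ_mem, toFinite _⟩⟩
  obtain ⟨U, rfl⟩ := hcount.exists_eq_range hne
  have hc : ∀ x, ∃ n, x ∈ U n := fun x => by
    obtain ⟨_, ⟨n, rfl⟩, hx⟩ := h𝒰.exists_mem x
    exact ⟨n, hx⟩
  have ho : ∀ n, IsOpen (U n) := fun n => h𝒰.1 _ (mem_range_self n)
  let ν : X → ℕ := fun x => Nat.find (hc x)
  have hν : ∀ x, x ∈ U (ν x) := fun x => Nat.find_spec (hc x)
  -- The least index `ν` cannot increase near `x`, so the half-lines `[ν x, ∞)` are lower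
  -- semicontinuous.
  obtain ⟨f, hf, hfm⟩ := h (ULift.{max u v} ℝ) (fun x => {y | (ν x : ℝ) ≤ y.down})
    (fun x => ⟨⟨⟨ν x⟩, le_refl (ν x : ℝ)⟩, isClosed_le continuous_const continuous_uliftDown, by
      intro y hy z hz a b ha hb hab
      exact convex_Ici (ν x : ℝ) hy hz ha hb hab⟩)
    (fun x => .inr ⟨⊤, by
      have : FiniteDimensional ℝ (ULift.{max u v} ℝ) := inferInstance
      rw [AffineSubspace.direction_top]; infer_instance, fun _ _ => trivial⟩)
    (lowerHemicontinuous_of_eventually_mem fun x => by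
      filter_upwards [(ho _).mem_nhds (hν x)] with x' hx' y hy
      exact (Nat.cast_le.2 (Nat.find_min' (hc x') hx') : (ν x' : ℝ) ≤ ν x).trans hy)
  let F : X → ℝ := fun x => (f x).down
  have hF : Continuous F := continuous_uliftDown.comp hf
  -- The slack 1 gives a strict, open condition that still holds at `n = ν x`; where `F < N`, only
  -- `n ≤ N` can occur.
  let O : ℕ → Set X := fun n => U n ∩ {x | (n : ℝ) - 1 < F x}
  refine ⟨range O, isOpenCoverOf_range
    (fun n => (ho n).inter (isOpen_lt continuous_const hF))
    (fun x => ⟨ν x, hν x, ((sub_one_lt _).trans_le (hfm x) : (ν x : ℝ) - 1 < F x)⟩), ?_, fun x => ?_⟩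
  · rintro _ ⟨n, rfl⟩
    exact ⟨U n, mem_range_self n, inter_subset_left⟩
  obtain ⟨N, hN⟩ := exists_nat_gt (F x)
  refine ⟨{y | F y < N}, (isOpen_lt hF continuous_const).mem_nhds hN, ?_⟩
  refine Set.Finite.of_finite_image (f := Subtype.val)
    (((finite_Iic (N + 1)).image O).subset ?_) Subtype.val_injective.injOn
  rintro _ ⟨⟨_, n, rfl⟩, ⟨y, ⟨_, hy⟩, hy'⟩, rfl⟩
  refine ⟨n, ?_, rfl⟩
  have : (n : ℝ) - 1 < N := lt_trans hy hy'
  have : (n : ℝ) < (N + 1 : ℕ) := by push_cast; linarith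
  exact (Nat.cast_lt.1 this).le

theorem mainTheorem2 (X : Type u) [TopologicalSpace X] [T2Space X] :
    (CountablyParacompact X ∧ PFNormal X) ↔
      ∀ (E : Type (max u v)) [NormedAddCommGroup E] [NormedSpace ℝ E] (Φ : X → Set E),
        (∀ x, (Φ x).Nonempty ∧ IsClosed (Φ x) ∧ Convex ℝ (Φ x)) →
        (∀ x, IsCompact (Φ x) ∨ IsFiniteDimensionalSet (Φ x)) →
        LowerHemicontinuous Φ →
        ∃ f : X → E, Continuous f ∧ ∀ x, f x ∈ Φ x :=
  ⟨fun ⟨hcp, hX⟩ _ _ _ _ h hfin hΦ => hcp.exists_selection hX h hfin hΦ,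
    fun h => ⟨SelectionProperty.countablyParacompact.{u, v} h,
      SelectionProperty.pfNormal.{u, v} h⟩⟩
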